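/- Let $K,D$ be integers with $0\le D<K$ and let $\mathbb F$ be a finite field. All subscripts of messages are taken modulo $K$. A single unicast index coding problem with $K$ messages $x_0,\dots,x_{K-1}$ and $K$ receivers $R_0,\dots,R_{K-1}$ is given by sets $\mathcal K_k\subseteq\{x_j: j\ne k\}$: receiver $R_k$ wants $x_k$ and knows the messages in $\mathcal K_k$. An index code of length $N$ for messages in $\mathbb F^m$ is a (possibly nonlinear) encoder $(\mathbb F^m)^K\to\mathbb F^N$ from whose output each $R_k$, using also $\mathcal K_k$, can recover $x_k$ for all values of the messages; its rate is $m/N$, and the capacity is the supremum of the rates of all index codes ($m,N\ge1$). The side-information graph is the directed graph on $\{0,\dots,K-1\}$ with an arc $k\to j$ iff $x_j\in\mathcal K_k$, and its minrank over $\mathbb F$ is the least rank of a $K\times K$ matrix $A$ over $\mathbb F$ with $A_{kk}\neq0$ for all $k$ and $A_{kj}=0$ whenever $j\ne k$ and $k\to j$ is not an arc. AIR matrix. For $m\ge n\geq 1$, the $m\times n$ AIR matrix is the $0/1$ matrix built as follows (rows and columns numbered from $0$). Write $m=qn+r$ with $0\le r<n$; the first $qn$ rows are $q$ copies of $I_n$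 stacked vertically. If $r>0$, write $n=q'r+r'$ with $0\le r'<r$; the first $q'r$ columns of the last $r$ rows are $q'$ copies of $I_r$ placed side by side, and, if $r'>0$, the remaining $r\times r'$ block is the $r\times r'$ AIR matrix. Let $\mathbf L$ be the $K\times(K-D)$ AIR matrix, and let $c_b=\sum_{j=0}^{K-1}\mathbf L(j,b)\,x_j$ for $0\le b<K-D$. Let $\lambda_{-1}=K-D$, $\lambda_0=D$, let $\lambda_{i+1}$ be the remainder of $\lambda_{i-1}$ on division by $\lambda_i$ as long as $\lambda_i\ne0$, and let $\lambda_l$ be the last nonzero term of this sequence. For $0\le k<K-D-\lambda_l$ let $d_{down}(k)=k'-k$ with $k'$ the largest index $>k$ such that $\mathbf L(k',k)=1$; let $\mu_k=k''-k$ with $k''$ the least index $>k$ such that $\mathbf L(k+d_{down}(k),k'')=1$; and let $t_{k,1}<\dots<t_{k,p_k}$ be all integers $t\geq 1$ with $k+d_{down}(k)+t<K$ and $\mathbf L(k+d_{down}(k)+t,\,k+\mu_k)=1$. For each $k$ let $B_k$ be the following set of indices: $B_k=\{k,\;k+\mu_k,\;k+t_{k,1},\dots,k+t_{k,p_k}\}$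 if $0\le k<K-D-\lambda_l$; $B_k=\{k\}$ if $K-D-\lambda_l\le k<K-D$; $B_k=\{k\bmod(K-D)\}$ if $K-D\le k<K$. Let $\gamma_k$ be the set of messages $x_j$, $j\neq k$, that occur with nonzero coefficient in $\sum_{b\in B_k}c_b$ computed over $\mathbb F_2$. Then $\gamma_k\subseteq\{x_{k+1},\dots,x_{k+D}\}$ for every $k$, and for the index coding problem with $K$ messages and $K$ receivers in which $R_k$ wants $x_k$ and has side-information $\gamma_k$, the capacity over $\mathbb F$ is $\frac1{K-D}$ and the minrank of the side-information graph over $\mathbb F$ is $K-D$. -/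

import Mathlib

namespace IndexCoding

/-! Single unicast index coding problems, index codes, capacity and minrank. -/

/-- A single unicast index coding problem with `K` messages `x_0, …, x_{K-1}` and `K` receivers:
receiver `R_k` wants `x_k` and knows the messages `x_j`, `j ∈ sideInfo k`. -/
structure Problem (K : ℕ) where
  sideInfo : Fin K → Finset (Fin K)
  notMem_sideInfo : ∀ k, k ∉ sideInfo k

/-- An index code of length `N` over `F` for messages of `m` symbols each (`m = 1` is the scalar
case): an encoder for which every receiver has a decoder that recovers the wanted message from the
codeword and the side-information, whatever the messages are. The encoder may be nonlinear. -/
def IsIndexCode {K : ℕ} (P : Problem K) (F : Type*) (m N : ℕ)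
    (E : (Fin K → Fin m → F) → (Fin N → F)) : Prop :=
  ∀ k : Fin K, ∃ decode : (Fin N → F) → (P.sideInfo k → Fin m → F) → (Fin m → F),
    ∀ x : Fin K → Fin m → F, decode (E x) (fun j => x j) = x k

/-- The rates `m / N` (symbols per message and channel use) of the index codes over `F`. -/
def achievableRates {K : ℕ} (P : Problem K) (F : Type*) : Set ℝ :=
  {R | ∃ m N : ℕ, 0 < m ∧ 0 < N ∧
    (∃ E : (Fin K → Fin m → F) → (Fin N → F), IsIndexCode P F m N E) ∧ R = (m : ℝ) / (N : ℝ)}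

/-- `C` is the (symmetric) capacity of `P` over `F`: the supremum of the achievable rates. -/
def IsCapacity {K : ℕ} (P : Problem K) (F : Type*) (C : ℝ) : Prop :=
  IsLUB (achievableRates P F) C

/-- The side-information graph: an arc `k → j` exactly if `R_k` knows `x_j`. -/
def Problem.graph {K : ℕ} (P : Problem K) : Digraph (Fin K) where
  Adj k j := j ∈ P.sideInfo k

/-- `A` fits the directed graph `G`: nonzero diagonal, and zero off the diagonal at non-arcs. -/
def Fits {V F : Type*} [Field F] (G : Digraph V) (A : Matrix V V F) : Prop :=
  (∀ i, A i i ≠ 0) ∧ ∀ i j, i ≠ j → ¬ G.Adj i j → A i j = 0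

/-- The minrank of `G` over `F`: the least rank of a matrix that fits `G` (the identity matrix
always fits, so the set is never empty). -/
noncomputable def minrank {V : Type*} [Fintype V] (F : Type*) [Field F] (G : Digraph V) : ℕ :=
  sInf {r | ∃ A : Matrix V V F, Fits G A ∧ A.rank = r}

/-- One-sided symmetric neighbouring side-information `{x_{k+1}, …, x_{k+D}}`, subscripts
modulo `K`. -/
def oneSided (K D : ℕ) (k : Fin K) : Finset (Fin K) :=
  Finset.univ.filter fun j => (j : ℕ) ∈ (Finset.Icc 1 D).image fun i => ((k : ℕ) + i) % K

/-! The AIR matrix. -/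

/-- Entry in row `j` and column `k` of the `m × n` AIR matrix (`n ≤ m`), rows and columns numbered
from `0`. With `m = q n + r`, the first `q n` rows are `q` stacked copies of `I_n`. With
`n = q' r + r'`, the first `q' r` columns of the remaining `r` rows are `q'` copies of `I_r` side by
side, and the remaining `r × r'` block is filled in the same way, until nothing is left. -/
def air (m n j k : ℕ) : ℕ :=
  if n = 0 then 0
  else if j < m / n * n then (if j % n = k then 1 else 0)
  else if m % n = 0 then 0
  else if k < n / (m % n) * (m % n) then
    (if k % (m % n) = j - m / n * n then 1 else 0)
  else air (m % n) (n % (m % n)) (j - m / n * n) (k - n / (m % n) * (m % n))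
termination_by n
decreasing_by
  have h1 : n % (m % n) < m % n := Nat.mod_lt _ (by omega)
  have h2 : m % n < n := Nat.mod_lt _ (by omega)
  omega

/-- The `(K, D)` AIR matrix `L`, of size `K × (K - D)`. -/
def L (K D j k : ℕ) : ℕ := air K (K - D) j k

/-- The remainders of the Euclidean algorithm on `K - D` and `D`, numbered from `-1` in the usual
notation: `lam K D i` is `λ_{i-1}`, with `λ_{-1} = K - D`, `λ_0 = D`. -/
def lam (K D : ℕ) : ℕ → ℕ
  | 0 => K - D
  | 1 => D
  | i + 2 => lam K D i % lam K D (i + 1)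

/-- `λ_l`, the last `λ_i` before the first zero. -/
noncomputable def lamLast (K D : ℕ) : ℕ := lam K D (sInf {i | lam K D (i + 1) = 0})

/-! Distances between the ones of `L`. -/

/-- Down-distance of `L(k,k)`: `k' - k` for the largest `k' > k` with `L(k',k) = 1`. -/
noncomputable def dDown (K D k : ℕ) : ℕ := sSup {j | k < j ∧ j < K ∧ L K D j k = 1} - k

/-- Right-distance of `L(j,k)`: `k' - k` for the least `k' > k` with `L(j,k') = 1`. -/
noncomputable def dRight (K D j k : ℕ) : ℕ := sInf {c | k < c ∧ c < K - D ∧ L K D j c = 1} - k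

/-- `μ_k`, the right-distance of `L(k + d_down(k), k)`. -/
noncomputable def mu (K D k : ℕ) : ℕ := dRight K D (k + dDown K D k) k

/-- The distances `t_{k,1} < ⋯ < t_{k,p_k}` from `L(k + d_down(k), k + μ_k)` to the ones below it
in its column. -/
noncomputable def downDists (K D k : ℕ) : Finset ℕ :=
  (Finset.Icc 1 K).filter fun t =>
    k + dDown K D k + t < K ∧ L K D (k + dDown K D k + t) (k + mu K D k) = 1

/-- The indices of the broadcast symbols that `R_k` adds to decode `x_k`: `c_{k mod (K-D)}` if
`k ≥ K - D`, only `c_k` if `K - D - λ_l ≤ k < K - D`, and otherwise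
`c_k, c_{k+μ_k}, c_{k+t_{k,1}}, …, c_{k+t_{k,p_k}}`. -/
noncomputable def usedSymbols (K D k : ℕ) : Finset ℕ :=
  if K - D ≤ k then {k % (K - D)}
  else if K - D - lamLast K D ≤ k then {k}
  else insert k (insert (k + mu K D k) ((downDists K D k).image fun t => k + t))

/-- The reduced side-information `γ_k`: the messages other than `x_k` that occur in the sum over
`F_2` of the broadcast symbols `c_b = ∑_j L(j,b) x_j` used by `R_k`. -/
noncomputable def gamma (K D : ℕ) (k : Fin K) : Finset (Fin K) :=
  Finset.univ.filter fun j => j ≠ k ∧ ∑ b ∈ usedSymbols K D k, (L K D j b : ZMod 2) ≠ 0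

/-- The `(K, D, {γ_k})` non-symmetric index coding problem. -/
noncomputable def reducedProblem (K D : ℕ) : Problem K where
  sideInfo := gamma K D
  notMem_sideInfo k := by simp [gamma]

end IndexCoding

/-!
The AIR matrix is a tiling of the `K × (K - D)` rectangle by squares, each filled with an identity
matrix: the Euclidean algorithm run by subtraction, cutting a square off the top when the rectangle
is at least as high as wide and off the left when it is wider than high (`tile`, `air_eq_tile`).
Write `n = K - D`.

*Decoding.* A column `k < n - λ_l` runs through a square of size `s` that touches the bottom of the
rectangle and is not the last one (`exists_bottomSquare`); say it starts at column `c`, so that the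
rectangle left over to its right has width `w = n - c - s > 0`, and `k = c + i`. The lowest one of
column `k` is in row `K - s + i`, the next one of that row is in column `k'' = k + μ_k = c + s +
(i mod w)`, and the columns `k + t` run through the same square. Hence in
`c_k - c_{k''} + ∑_t c_{k+t}` the rows from `K - s + i` downwards cancel, in the rows from `K - s`
to `K - s + i` only the column `k''` contributes, and a row above `K - s` has at most one one in the
columns `≥ c`. So all coefficients are `0` or `±1`: the
combination has over every field the same support as the sum of the same symbols over `F_2`, and it
lets `R_k` decode (`isDecodingSign_bottomSquare`). The other receivers use a single symbol, whose
coefficients are `0` or `1`. That the support lies in `{k, …, k + D}` modulo `K` follows from the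
distances between ones in the tiling (`add_le_of_tile_mod`, `row_bound_of_tile`,
`BottomSquare.row_bound_above`). This gives a scalar linear code of length `n` and a fitting matrix
of rank at most `n`.

*Converse.* Because `γ_k ⊆ {k+1, …, k+D}`, the side-information graph is acyclic on the first `n`
vertices. Therefore a code is injective on the messages that vanish outside of them, and `n m ≤ N`
by counting (`IsIndexCode.mul_le`); and the leading `n × n` block of a fitting matrix is triangular
with nonzero diagonal (`Fits.le_rank`).
-/

namespace IndexCoding

/-! ### Tiling a rectangle by squares -/

/-- Entry `(j, k)` of the `m × n` matrix cut into squares by the subtractive Euclidean algorithm,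
each square being an identity matrix: one square is cut off the top if `n ≤ m`, and off the left if
`m < n`. -/
def tile (m n j k : ℕ) : ℕ :=
  if m = 0 ∨ n = 0 then 0
  else if n ≤ m then (if j < n then (if j = k then 1 else 0) else tile (m - n) n (j - n) k)
  else if k < m then (if j = k then 1 else 0) else tile m (n - m) j (k - m)
termination_by m + n

theorem tile_vert {m n j k : ℕ} (hn : 0 < n) (h : n ≤ m) :
    tile m n j k = if j < n then (if j = k then 1 else 0) else tile (m - n) n (j - n) k := by
  rw [tile, if_neg (by omega), if_pos h]

theorem tile_horiz {m n j k : ℕ} (hm : 0 < m) (h : m < n) :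
    tile m n j k = if k < m then (if j = k then 1 else 0) else tile m (n - m) j (k - m) := by
  rw [tile, if_neg (by omega), if_neg (by omega)]

theorem tile_of_zero {m n j k : ℕ} (h : m = 0 ∨ n = 0) : tile m n j k = 0 := by
  rw [tile, if_pos h]

/-- Induction along the subtractive Euclidean algorithm. -/
theorem tile_induction {P : ℕ → ℕ → Prop} (zero : ∀ m n, m = 0 ∨ n = 0 → P m n)
    (vert : ∀ m n, 0 < n → n ≤ m → P (m - n) n → P m n)
    (horiz : ∀ m n, 0 < m → m < n → P m (n - m) → P m n) (m n : ℕ) : P m n := by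
  induction h : m + n using Nat.strong_induction_on generalizing m n with
  | _ N ih =>
    by_cases h0 : m = 0 ∨ n = 0
    · exact zero m n h0
    by_cases h1 : n ≤ m
    · exact vert m n (by omega) h1 (ih _ (by omega) _ _ rfl)
    · exact horiz m n (by omega) (by omega) (ih _ (by omega) _ _ rfl)

theorem tile_eq_zero_or_one (m n : ℕ) : ∀ j k, tile m n j k = 0 ∨ tile m n j k = 1 := by
  induction m, n using tile_induction with
  | zero m n h => intro j k; exact .inl (tile_of_zero h)
  | vert m n hn h ih =>
    intro j k
    rw [tile_vert hn h]
    split_ifs <;> simp [ih]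
  | horiz m n hm h ih =>
    intro j k
    rw [tile_horiz hm h]
    split_ifs <;> simp [ih]

/-- Row `i` has a one in column `i % n`; by `mod_le_of_tile` it is the first one of the row. -/
theorem tile_mod (m n : ℕ) (hn : 0 < n) : ∀ i < m, tile m n i (i % n) = 1 := by
  induction m, n using tile_induction with
  | zero m n h => intro i hi; omega
  | vert m n _ h ih =>
    intro i hi
    rw [tile_vert hn h]
    split_ifs with h1 h2
    · rfl
    · exact absurd (Nat.mod_eq_of_lt h1).symm h2
    · rw [Nat.mod_eq_sub_mod (by omega)]
      exact ih hn _ (by omega)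
  | horiz m n hm h ih =>
    intro i hi
    rw [Nat.mod_eq_of_lt (by omega), tile_horiz hm h]
    simp [hi]

theorem mod_le_of_tile (m n : ℕ) : ∀ i < m, ∀ c, tile m n i c = 1 → i % n ≤ c := by
  induction m, n using tile_induction with
  | zero m n h => intro i hi c hc; simp [tile_of_zero h] at hc
  | vert m n hn h ih =>
    intro i hi c hc
    rw [tile_vert hn h] at hc
    split_ifs at hc with h1 h2
    · rw [Nat.mod_eq_of_lt h1, h2]
    · rw [Nat.mod_eq_sub_mod (by omega)]
      exact ih _ (by omega) _ hc
  | horiz m n hm h ih =>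
    intro i hi c hc
    rw [Nat.mod_eq_of_lt (by omega)]
    rw [tile_horiz hm h] at hc
    split_ifs at hc <;> omega

/-- The ones above the first one of a row, in the same column, are at distance at least `n`. -/
theorem add_le_of_tile_mod (m n : ℕ) :
    ∀ i < m, ∀ j < i, tile m n j (i % n) = 1 → j + n ≤ i := by
  induction m, n using tile_induction with
  | zero m n h => intro i hi j hj hc; simp [tile_of_zero h] at hc
  | vert m n hn h ih =>
    intro i hi j hj hc
    rw [tile_vert hn h] at hc
    split_ifs at hc with h1 h2
    · by_contra h3
      by_cases h4 : i < n
      · rw [Nat.mod_eq_of_lt h4] at h2; omega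
      · rw [Nat.mod_eq_sub_mod (by omega), Nat.mod_eq_of_lt (by omega)] at h2; omega
    · rw [Nat.mod_eq_sub_mod (by omega)] at hc
      have := ih _ (by omega) _ (by omega) hc
      omega
  | horiz m n hm h ih =>
    intro i hi j hj hc
    rw [Nat.mod_eq_of_lt (by omega), tile_horiz hm h] at hc
    split_ifs at hc
    omega

/-- In the last `gcd m n` columns, which form the columns of the last square, the ones of column `k`
are in rows `≤ k + (m - n)`. -/
theorem row_bound_of_tile (m n : ℕ) :
    ∀ j k, tile m n j k = 1 → n ≤ k + Nat.gcd m n → j + n ≤ k + m := by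
  induction m, n using tile_induction with
  | zero m n h => intro j k hc; simp [tile_of_zero h] at hc
  | vert m n hn h ih =>
    intro j k hc hk
    rw [tile_vert hn h] at hc
    split_ifs at hc with h1 h2
    · omega
    · have := ih _ _ hc (by rwa [Nat.gcd_sub_self_left h])
      omega
  | horiz m n hm h ih =>
    intro j k hc hk
    rw [← Nat.gcd_sub_self_right h.le] at hk
    rw [tile_horiz hm h] at hc
    split_ifs at hc with h1 h2
    · have := Nat.le_of_dvd (by omega) (Nat.gcd_dvd_right m (n - m))
      omega
    · have := ih _ _ hc (by omega)
      omega

/-! ### Squares that touch the bottom -/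

/-- The tiling of the `m × n` rectangle has a square of size `s` in the rows `m - s, …, m - 1` and
the columns `c, …, c + s - 1`, with a nonempty rectangle to its right that is tiled in turn. Above
the square, a row `j` has at most one one in the columns `≥ c`; if it is in column `a`, then
`j ≤ a + (m - s - n)` as integers. -/
structure BottomSquare (m n c s : ℕ) : Prop where
  le_height : s ≤ m
  lt_width : c + s < n
  add_le_height : n ≤ m → s + n ≤ m
  unique_above : ∀ j a b, j + s < m → c ≤ a → c ≤ b → tile m n j a = 1 → tile m n j b = 1 → a = b
  row_bound_above : ∀ j a, j + s < m → c ≤ a → tile m n j a = 1 → j + s + n ≤ m + a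
  tile_inside : ∀ i < s, ∀ a < s, tile m n (m - s + i) (c + a) = if i = a then 1 else 0
  tile_right : ∀ i < s, ∀ a, tile m n (m - s + i) (c + s + a) = tile s (n - c - s) i a

/-- Every column but the last `gcd m n` runs through a square as in `BottomSquare`. -/
theorem exists_bottomSquare (m n : ℕ) : ∀ k, k + Nat.gcd m n < n →
    ∃ c s, BottomSquare m n c s ∧ c ≤ k ∧ k < c + s := by
  induction m, n using tile_induction with
  | zero m n h =>
    rcases h with rfl | rfl <;> simp
  | vert m n hn h ih =>
    intro k hk
    obtain ⟨c, s, hs, hck, hks⟩ := ih k (by rwa [Nat.gcd_sub_self_left h])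
    have h1 := hs.le_height
    have h2 := hs.lt_width
    refine ⟨c, s, ⟨by omega, h2, by omega, ?_, ?_, ?_, ?_⟩, hck, hks⟩
    · intro j a b hj ha hb hja hjb
      rw [tile_vert hn h] at hja hjb
      by_cases hjn : j < n
      · simp only [hjn, if_true] at hja hjb
        split_ifs at hja hjb
        omega
      · simp only [hjn, if_false] at hja hjb
        exact hs.unique_above _ a b (by omega) ha hb hja hjb
    · intro j a hj ha hja
      rw [tile_vert hn h] at hja
      split_ifs at hja
      · omega
      · have := hs.row_bound_above _ a (by omega) ha hja
        omega
    · intro i hi a ha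
      rw [tile_vert hn h, if_neg (by omega), ← hs.tile_inside i hi a ha]
      congr 1; omega
    · intro i hi a
      rw [tile_vert hn h, if_neg (by omega), ← hs.tile_right i hi a]
      congr 1; omega
  | horiz m n hm h ih =>
    intro k hk
    by_cases hkm : k < m
    · refine ⟨0, m, ⟨le_rfl, by omega, by omega, by omega, by omega, ?_, ?_⟩, by omega, by omega⟩
      · intro i hi a ha
        rw [tile_horiz hm h, if_pos (by omega)]
        simp
      · intro i hi a
        rw [tile_horiz hm h, if_neg (by omega)]
        congr 1 <;> omega
    rw [← Nat.gcd_sub_self_right h.le] at hk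
    obtain ⟨c, s, hs, hck, hks⟩ := ih (k - m) (by omega)
    have h1 := hs.le_height
    have h2 := hs.lt_width
    refine ⟨m + c, s, ⟨h1, by omega, by omega, ?_, ?_, ?_, ?_⟩, by omega, by omega⟩
    · intro j a b hj ha hb hja hjb
      rw [tile_horiz hm h, if_neg (by omega)] at hja hjb
      have := hs.unique_above _ _ _ hj (by omega) (by omega) hja hjb
      omega
    · intro j a hj ha hja
      rw [tile_horiz hm h, if_neg (by omega)] at hja
      have := hs.row_bound_above _ _ hj (by omega) hja
      omega
    · intro i hi a ha
      rw [tile_horiz hm h, if_neg (by omega), ← hs.tile_inside i hi a ha]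
      congr 1; omega
    · intro i hi a
      rw [tile_horiz hm h, if_neg (by omega), show n - (m + c) - s = n - m - c - s by omega,
        ← hs.tile_right i hi a]
      congr 1; omega

/-! ### The AIR matrix as a tiling -/

theorem tile_vert_iterate {n : ℕ} (hn : 0 < n) (q : ℕ) : ∀ {m j k : ℕ}, q * n ≤ m →
    tile m n j k = if j < q * n then (if j % n = k then 1 else 0)
      else tile (m - q * n) n (j - q * n) k := by
  induction q with
  | zero => intro m j k _; simp
  | succ q ih =>
    intro m j k h
    rw [Nat.succ_mul] at h ⊢
    rw [tile_vert hn (by omega)]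
    by_cases h1 : j < n
    · rw [if_pos h1, if_pos (show j < q * n + n by omega), Nat.mod_eq_of_lt h1]
    rw [if_neg h1, ih (by omega), ← Nat.mod_eq_sub_mod (by omega)]
    by_cases h2 : j < q * n + n
    · rw [if_pos h2, if_pos (by omega)]
    · rw [if_neg h2, if_neg (by omega)]
      congr 1 <;> omega

theorem tile_horiz_iterate {m j : ℕ} (hj : j < m) (q : ℕ) : ∀ {n k : ℕ}, q * m ≤ n → k < n →
    tile m n j k = if k < q * m then (if k % m = j then 1 else 0)
      else tile m (n - q * m) j (k - q * m) := by
  induction q with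
  | zero => intro n k _ _; simp
  | succ q ih =>
    intro n k h hk
    rw [Nat.succ_mul] at h ⊢
    by_cases h1 : k < m
    · rw [if_pos (by omega), Nat.mod_eq_of_lt h1]
      rcases (show m ≤ n by omega).lt_or_eq with h2 | rfl
      · rw [tile_horiz (by omega) h2, if_pos h1]
        simp only [eq_comm]
      · rw [tile_vert (by omega) le_rfl, if_pos hj]
        simp only [eq_comm]
    rw [tile_horiz (by omega) (by omega), if_neg h1, ih (by omega) (by omega),
      ← Nat.mod_eq_sub_mod (by omega)]
    by_cases h2 : k < q * m + m
    · rw [if_pos h2, if_pos (by omega)]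
    · rw [if_neg h2, if_neg (by omega)]
      congr 1 <;> omega

theorem air_eq_tile {m n j k : ℕ} (hj : j < m) (hk : k < n) : air m n j k = tile m n j k := by
  induction n using Nat.strong_induction_on generalizing m j k with
  | _ n ih =>
    have hdm := Nat.div_add_mod' m n
    have hr := Nat.mod_lt m (show 0 < n by omega)
    rw [air, if_neg (by omega), tile_vert_iterate (by omega) (m / n) (by omega),
      show m - m / n * n = m % n by omega]
    split_ifs with h1 h2 h3 h4 h5 <;> try rfl
    · omega
    · rw [tile_horiz_iterate (by omega) (n / (m % n)) (by have := Nat.div_add_mod' n (m % n); omega)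
        hk, if_pos h4, if_pos h5]
    · rw [tile_horiz_iterate (by omega) (n / (m % n)) (by have := Nat.div_add_mod' n (m % n); omega)
        hk, if_pos h4, if_neg h5]
    · have hdm' := Nat.div_add_mod' n (m % n)
      have hr' := Nat.mod_lt n (show 0 < m % n by omega)
      rw [tile_horiz_iterate (by omega) (n / (m % n)) (by omega) hk, if_neg h4,
        show n - n / (m % n) * (m % n) = n % (m % n) by omega]
      exact ih _ (by omega) (by omega) (by omega)

theorem L_eq_tile {K D j k : ℕ} (hj : j < K) (hk : k < K - D) :
    L K D j k = tile K (K - D) j k := air_eq_tile hj hk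

/-! ### The last nonzero remainder -/

theorem gcd_lam (K D i : ℕ) :
    Nat.gcd (lam K D i) (lam K D (i + 1)) = Nat.gcd (K - D) D := by
  induction i with
  | zero => rfl
  | succ i ih => rw [← ih, lam, Nat.gcd_comm, ← Nat.gcd_rec, Nat.gcd_comm]

theorem exists_lam_eq_zero (K D : ℕ) : ∃ i, lam K D (i + 1) = 0 := by
  by_contra! h
  have key : ∀ i, lam K D (i + 1) + i ≤ D := by
    intro i
    induction i with
    | zero => simp [lam]
    | succ i ih =>
      have : lam K D (i + 1 + 1) < lam K D (i + 1) := by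
        rw [lam]; exact Nat.mod_lt _ (Nat.pos_of_ne_zero (h i))
      omega
  have := key (D + 1)
  omega

theorem lamLast_eq_gcd {K D : ℕ} (hD : D < K) : lamLast K D = Nat.gcd K (K - D) := by
  have h : lam K D (sInf {i | lam K D (i + 1) = 0} + 1) = 0 := Nat.sInf_mem (exists_lam_eq_zero K D)
  have h2 := gcd_lam K D (sInf {i | lam K D (i + 1) = 0})
  rw [h, Nat.gcd_zero_right] at h2
  rw [lamLast, h2, Nat.gcd_comm, Nat.gcd_comm K]
  conv_rhs => rw [← Nat.gcd_sub_self_right (Nat.sub_le K D), show K - (K - D) = D by omega]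
  exact Nat.gcd_comm _ _

/-! ### Signed sums of broadcast symbols -/

/-- The signs `ε b = ±1` turn the symbols used by `R_k` into an integer combination of the messages
in which `x_k` has coefficient `1`, every nonzero coefficient is odd, and the other messages that
occur lie in `{x_{k+1}, …, x_{k+D}}`, subscripts modulo `K`. Oddness makes the support agree with
the support over `F_2`. -/
structure IsDecodingSign (K D k : ℕ) (ε : ℕ → ℤ) : Prop where
  eq_one_or : ∀ b, ε b = 1 ∨ ε b = -1
  used_subset : usedSymbols K D k ⊆ Finset.range (K - D)
  coeff_self : ∑ b ∈ usedSymbols K D k, ε b * L K D k b = 1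
  coeff_odd : ∀ j < K, ∑ b ∈ usedSymbols K D k, ε b * L K D j b ≠ 0 →
    Odd (∑ b ∈ usedSymbols K D k, ε b * (L K D j b : ℤ))
  window : ∀ j < K, j ≠ k → ∑ b ∈ usedSymbols K D k, ε b * L K D j b ≠ 0 →
    (k < j ∧ j ≤ k + D) ∨ (j < k ∧ j + K ≤ k + D)

theorem L_diag {K D k : ℕ} (hD : D < K) (hk : k < K) : L K D k (k % (K - D)) = 1 := by
  rw [L_eq_tile hk (Nat.mod_lt _ (by omega))]
  exact tile_mod _ _ (by omega) _ hk

/-- The entry `(k, k % (K - D))` is a one by `L_diag`; the ones above it in its column are at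
distance at least `K - D`. -/
theorem add_le_of_L_mod {K D j k : ℕ} (hD : D < K) (hk : k < K) (hjk : j < k)
    (h : L K D j (k % (K - D)) ≠ 0) : j + (K - D) ≤ k := by
  rw [L_eq_tile (by omega) (Nat.mod_lt _ (by omega))] at h
  exact add_le_of_tile_mod _ _ _ hk _ hjk ((tile_eq_zero_or_one _ _ _ _).resolve_left h)

theorem L_eq_zero_of_lt {K D j c : ℕ} (hjc : j < c) (hc : c < K - D) : L K D j c = 0 := by
  by_contra h
  have := add_le_of_L_mod (K := K) (D := D) (k := c) (by omega) (by omega) hjc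
    (by rwa [Nat.mod_eq_of_lt hc])
  omega

/-- For a single used symbol only the entries below row `k` need attention: those above are handled
by `add_le_of_L_mod`, and come from the wrap-around modulo `K`. -/
theorem isDecodingSign_singleton {K D k : ℕ} (hD : D < K) (hk : k < K)
    (hu : usedSymbols K D k = {k % (K - D)})
    (hw : ∀ j < K, k < j → L K D j (k % (K - D)) = 1 → j ≤ k + D) :
    IsDecodingSign K D k fun _ => 1 := by
  have h01 : ∀ j < K, L K D j (k % (K - D)) = 0 ∨ L K D j (k % (K - D)) = 1 := fun j hj => by
    rw [L_eq_tile hj (Nat.mod_lt _ (by omega))]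
    exact tile_eq_zero_or_one _ _ _ _
  refine ⟨by simp, ?_, ?_, ?_, ?_⟩
  · simpa [hu] using Nat.mod_lt _ (by omega)
  · simp [hu, L_diag hD hk]
  · intro j hj h
    simp only [hu, Finset.sum_singleton, one_mul] at h ⊢
    rcases h01 j hj with h' | h' <;> simp [h'] at h ⊢
  · intro j hj hjk h
    simp only [hu, Finset.sum_singleton, one_mul, Nat.cast_ne_zero] at h
    rcases hjk.lt_or_gt with h1 | h1
    · have := add_le_of_L_mod hD hk h1 h
      omega
    · exact .inl ⟨h1, hw j hj h1 ((h01 j hj).resolve_left h)⟩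

/-- The symbol `c_{k+μ_k}` gets the sign `-1`: it has to cancel, in every characteristic, the
lowest one of column `k` and the ones of the columns `k + t` in the bottom square. -/
theorem isDecodingSign_bottomSquare {K D k c s : ℕ} (hk : k + lamLast K D < K - D)
    (hs : BottomSquare K (K - D) c s) (hck : c ≤ k) (hks : k < c + s) :
    IsDecodingSign K D k fun b => if b = k + mu K D k then -1 else 1 := by
  obtain ⟨i, rfl⟩ := Nat.exists_eq_add_of_le hck
  have hi : i < s := by omega
  have hsn := hs.add_le_height (by omega)
  have hcs := hs.lt_width
  have hw : 0 < K - D - c - s := by omega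
  have hin : ∀ i' < s, ∀ a < s, L K D (K - s + i') (c + a) = if i' = a then 1 else 0 :=
    fun i' hi' a ha => by rw [L_eq_tile (by omega) (by omega), hs.tile_inside i' hi' a ha]
  have hright : ∀ i' < s, ∀ a < K - D - c - s,
      L K D (K - s + i') (c + s + a) = tile s (K - D - c - s) i' a :=
    fun i' hi' a ha => by rw [L_eq_tile (by omega) (by omega), hs.tile_right i' hi' a]
  -- the lowest one of column `k`, then the next one in its row
  have hdown : c + i + dDown K D (c + i) = K - s + i := by
    have : IsGreatest {j | c + i < j ∧ j < K ∧ L K D j (c + i) = 1} (K - s + i) := by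
      refine ⟨⟨by omega, by omega, by rw [hin i hi i hi, if_pos rfl]⟩, ?_⟩
      rintro j ⟨_, hjK, hj⟩
      by_contra! hlt
      have h := hin (j - (K - s)) (by omega) i hi
      rw [show K - s + (j - (K - s)) = j by omega, hj, if_neg (by omega)] at h
      omega
    rw [dDown, this.csSup_eq]
    omega
  set f := i % (K - D - c - s) with hf
  have hfw : f < K - D - c - s := Nat.mod_lt _ hw
  have hfi : f ≤ i := Nat.mod_le _ _
  have htf : tile s (K - D - c - s) i f = 1 := tile_mod _ _ hw _ hi
  have hmu : c + i + mu K D (c + i) = c + s + f := by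
    have : IsLeast {b | c + i < b ∧ b < K - D ∧ L K D (K - s + i) b = 1} (c + s + f) := by
      refine ⟨⟨by omega, by omega, by rw [hright i hi f hfw, htf]⟩, ?_⟩
      rintro b ⟨hib, hbn, hb⟩
      by_cases hbs : b < c + s
      · have h := hin i hi (b - c) (by omega)
        rw [show c + (b - c) = b by omega, hb, if_neg (by omega)] at h
        omega
      · have h := hright i hi (b - (c + s)) (by omega)
        rw [show c + s + (b - (c + s)) = b by omega, hb] at h
        have := mod_le_of_tile _ _ _ hi _ h.symm
        omega
    rw [mu, hdown, dRight, this.csInf_eq]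
    omega
  have hmem : ∀ t, t ∈ downDists K D (c + i) ↔
      1 ≤ t ∧ i + t < s ∧ tile s (K - D - c - s) (i + t) f = 1 := by
    intro t
    rw [downDists, Finset.mem_filter, Finset.mem_Icc, hdown, hmu]
    constructor
    · rintro ⟨h1, h2, h3⟩
      rw [add_assoc, hright _ (by omega) f hfw] at h3
      exact ⟨h1.1, by omega, h3⟩
    · rintro ⟨h1, h2, h3⟩
      refine ⟨⟨h1, by omega⟩, by omega, ?_⟩
      rw [add_assoc, hright _ (by omega) f hfw, h3]
  have hused : usedSymbols K D (c + i) = insert (c + i) (insert (c + s + f)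
      ((downDists K D (c + i)).image fun t => c + i + t)) := by
    rw [usedSymbols, if_neg (by omega), if_neg (by omega), hmu]
  have hrange : ∀ b ∈ usedSymbols K D (c + i), c + i ≤ b ∧ b ≤ c + i + s ∧ b < K - D := by
    intro b hb
    simp only [hused, Finset.mem_insert, Finset.mem_image, hmem] at hb
    rcases hb with rfl | rfl | ⟨t, ht, rfl⟩ <;> omega
  -- the three kinds of symbols are pairwise different
  have hsum : ∀ j, ∑ b ∈ usedSymbols K D (c + i),
      (if b = c + i + mu K D (c + i) then (-1 : ℤ) else 1) * L K D j b =
      L K D j (c + i) - L K D j (c + s + f) +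
        ∑ t ∈ downDists K D (c + i), (L K D j (c + i + t) : ℤ) := by
    intro j
    rw [hmu, hused, Finset.sum_insert, Finset.sum_insert, Finset.sum_image, if_neg (by omega),
      if_pos rfl]
    · have : ∀ t ∈ downDists K D (c + i), (if c + i + t = c + s + f then (-1 : ℤ) else 1) *
          L K D j (c + i + t) = L K D j (c + i + t) := by
        intro t ht
        have := (hmem t).1 ht
        rw [if_neg (by omega), one_mul]
      rw [Finset.sum_congr rfl this]
      ring
    · intro a _ b _ h
      simpa using h
    · simp only [Finset.mem_image, hmem]
      rintro ⟨t, ht, h⟩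
      omega
    · simp only [Finset.mem_insert, Finset.mem_image, hmem]
      rintro (h | ⟨t, ht, h⟩) <;> omega
  have hLval : ∀ j < K, ∀ b ∈ usedSymbols K D (c + i), L K D j b = 0 ∨ L K D j b = 1 := by
    intro j hj b hb
    rw [L_eq_tile hj (hrange b hb).2.2]
    exact tile_eq_zero_or_one _ _ _ _
  -- above the bottom square at most one of the used columns has a one in a given row
  have hupper : ∀ j, j + s < K → ∀ b ∈ usedSymbols K D (c + i), L K D j b ≠ 0 →
      j ≤ c + i + D ∧ ∑ b' ∈ usedSymbols K D (c + i),
        (if b' = c + i + mu K D (c + i) then (-1 : ℤ) else 1) * L K D j b' =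
        if b = c + i + mu K D (c + i) then (-1 : ℤ) else 1 := by
    intro j hj b hb hne
    have hb' := hrange b hb
    have h1 := (hLval j (by omega) b hb).resolve_left hne
    have h1' := h1
    rw [L_eq_tile (by omega) hb'.2.2] at h1'
    refine ⟨?_, ?_⟩
    · have := hs.row_bound_above j b hj (by omega) h1'
      omega
    · rw [Finset.sum_eq_single b, h1]
      · simp
      · intro a ha hab
        have ha' := hrange a ha
        rcases hLval j (by omega) a ha with h0 | h0
        · simp [h0]
        · rw [L_eq_tile (by omega) ha'.2.2] at h0
          exact absurd (hs.unique_above j a b hj (by omega) (by omega) h0 h1') hab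
      · exact fun h => absurd hb h
  -- in the rows of the bottom square, the ones at and below the row of `k` cancel
  have hlower : ∀ i' < s, ∑ b ∈ usedSymbols K D (c + i),
      (if b = c + i + mu K D (c + i) then (-1 : ℤ) else 1) * L K D (K - s + i') b =
      if i' < i then -(tile s (K - D - c - s) i' f : ℤ) else 0 := by
    intro i' hi'
    have h : ∀ t ∈ downDists K D (c + i), (L K D (K - s + i') (c + i + t) : ℤ) =
        if i' - i = t then (if i < i' then 1 else 0) else 0 := by
      intro t ht
      have := (hmem t).1 ht
      rw [add_assoc, hin i' hi' _ (by omega)]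
      split_ifs <;> first | rfl | omega
    rw [hsum, hin i' hi' i hi, hright i' hi' f hfw, Finset.sum_congr rfl h, Finset.sum_ite_eq]
    rcases lt_trichotomy i' i with h1 | rfl | h1
    · simp [h1, h1.ne, h1.not_gt]
    · simp [htf]
    · have : i' - i ∈ downDists K D (c + i) ↔ tile s (K - D - c - s) i' f = 1 := by
        rw [hmem, show i + (i' - i) = i' by omega]
        exact ⟨fun h => h.2.2, fun h => ⟨by omega, hi', h⟩⟩
      simp only [this, h1, h1.ne', h1.not_gt, if_true, if_false]
      rcases tile_eq_zero_or_one s (K - D - c - s) i' f with h2 | h2 <;> simp [h2]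
  have hsplit : ∀ j < K, (j + s < K) ∨ ∃ i' < s, j = K - s + i' := fun j hj => by
    by_cases h : j + s < K
    · exact .inl h
    · exact .inr ⟨j - (K - s), by omega, by omega⟩
  have hkself : L K D (c + i) (c + i) = 1 := by
    have := L_diag (K := K) (D := D) (k := c + i) (by omega) (by omega)
    rwa [Nat.mod_eq_of_lt (by omega)] at this
  refine ⟨fun b => by split_ifs <;> simp, ?_, ?_, ?_, ?_⟩
  · intro b hb
    exact Finset.mem_range.2 (hrange b hb).2.2
  · rw [hsum, hkself, L_eq_zero_of_lt (by omega) (by omega), Finset.sum_eq_zero]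
    · simp
    · intro t ht
      have := (hmem t).1 ht
      rw [L_eq_zero_of_lt (by omega) (by omega), Nat.cast_zero]
  · intro j hj hne
    rcases hsplit j hj with hjs | ⟨i', hi', rfl⟩
    · obtain ⟨b, hb, hbne⟩ := Finset.exists_ne_zero_of_sum_ne_zero hne
      have hL : L K D j b ≠ 0 := fun h => hbne (by rw [h]; simp)
      rw [(hupper j hjs b hb hL).2]
      split_ifs <;> decide
    · rw [hlower i' hi'] at hne ⊢
      rcases tile_eq_zero_or_one s (K - D - c - s) i' f with h2 | h2 <;>
        simp only [h2] at hne ⊢ <;> split_ifs at hne ⊢ <;> simp at hne ⊢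
  · intro j hj hjk hne
    refine .inl ?_
    obtain ⟨b, hb, hbne⟩ := Finset.exists_ne_zero_of_sum_ne_zero hne
    have hL : L K D j b ≠ 0 := fun h => hbne (by rw [h]; simp)
    have hb' := hrange b hb
    refine ⟨?_, ?_⟩
    · by_contra hlt
      exact hL (L_eq_zero_of_lt (by omega) hb'.2.2)
    · rcases hsplit j hj with hjs | ⟨i', hi', rfl⟩
      · exact (hupper j hjs b hb hL).1
      · rw [hlower i' hi'] at hne
        split_ifs at hne with h1
        · have h2 := (tile_eq_zero_or_one s (K - D - c - s) i' f).resolve_left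
            (fun h => hne (by simp [h]))
          have := add_le_of_tile_mod _ _ _ hi _ h1 h2
          omega
        · exact absurd rfl hne

theorem exists_isDecodingSign {K D k : ℕ} (hD : D < K) (hk : k < K) :
    ∃ ε, IsDecodingSign K D k ε := by
  by_cases h1 : K - D ≤ k
  · exact ⟨_, isDecodingSign_singleton hD hk (by rw [usedSymbols, if_pos h1])
      fun j hj _ _ => by omega⟩
  by_cases h2 : K - D - lamLast K D ≤ k
  · have hmod : k % (K - D) = k := Nat.mod_eq_of_lt (by omega)
    refine ⟨_, isDecodingSign_singleton hD hk
      (by rw [usedSymbols, if_neg h1, if_pos h2, hmod]) fun j hj _ h => ?_⟩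
    rw [hmod, L_eq_tile hj (by omega)] at h
    rw [lamLast_eq_gcd hD] at h2
    have := row_bound_of_tile _ _ _ _ h (by omega)
    omega
  · obtain ⟨c, s, hs, hck, hks⟩ := exists_bottomSquare K (K - D) k
      (by rw [← lamLast_eq_gcd hD]; omega)
    exact ⟨_, isDecodingSign_bottomSquare (by omega) hs hck hks⟩

/-! ### The reduced side-information -/

/-- `γ_k` is the support of the signed combination, apart from `k` itself. -/
theorem IsDecodingSign.mem_gamma_iff {K D : ℕ} {k : Fin K} {ε : ℕ → ℤ}
    (hε : IsDecodingSign K D k ε) (j : Fin K) :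
    j ∈ gamma K D k ↔ j ≠ k ∧ ∑ b ∈ usedSymbols K D k, ε b * L K D j b ≠ 0 := by
  have h : (∑ b ∈ usedSymbols K D k, (L K D j b : ZMod 2)) =
      ((∑ b ∈ usedSymbols K D k, ε b * L K D j b : ℤ) : ZMod 2) := by
    push_cast
    refine Finset.sum_congr rfl fun b _ => ?_
    rcases hε.eq_one_or b with h | h <;> simp [h, ZMod.neg_eq_self_mod_two]
  rw [gamma, Finset.mem_filter, h, Ne, Ne, ZMod.intCast_zmod_eq_zero_iff_dvd]
  simp only [Finset.mem_univ, true_and, and_congr_right_iff]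
  refine fun _ => not_congr ⟨fun hd => ?_, fun h0 => by simp [h0]⟩
  by_contra hne
  have := hε.coeff_odd j j.2 hne
  rw [Int.odd_iff] at this
  omega

theorem gamma_window {K D : ℕ} (hD : D < K) {k j : Fin K} (h : j ∈ gamma K D k) :
    ((k : ℕ) < j ∧ (j : ℕ) ≤ k + D) ∨ ((j : ℕ) < k ∧ (j : ℕ) + K ≤ k + D) := by
  obtain ⟨ε, hε⟩ := exists_isDecodingSign hD k.2
  obtain ⟨hjk, hne⟩ := (hε.mem_gamma_iff j).1 h
  exact hε.window j j.2 (fun h => hjk (Fin.ext h)) hne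

theorem gamma_subset_oneSided {K D : ℕ} (hD : D < K) (k : Fin K) :
    gamma K D k ⊆ oneSided K D k := by
  intro j hj
  simp only [oneSided, Finset.mem_filter, Finset.mem_univ, true_and, Finset.mem_image,
    Finset.mem_Icc]
  rcases gamma_window hD hj with h | h
  · refine ⟨j - k, by omega, ?_⟩
    rw [show (k : ℕ) + (j - k) = j by omega, Nat.mod_eq_of_lt j.2]
  · refine ⟨j + K - k, by omega, ?_⟩
    rw [show (k : ℕ) + (j + K - k) = j + K by omega, Nat.add_mod_right, Nat.mod_eq_of_lt j.2]

/-- The side-information graph is acyclic on the first `K - D` vertices. -/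
theorem lt_of_mem_gamma {K D : ℕ} (hD : D < K) {k j : Fin K} (hk : (k : ℕ) < K - D)
    (h : j ∈ gamma K D k) : k < j := by
  rcases gamma_window hD h with h | h
  · exact h.1
  · omega

/-- A combination of the broadcast symbols over `F` in which only `x_k` and messages of `γ_k`
occur, `x_k` with coefficient `1`. -/
theorem exists_decodingVector {K D : ℕ} (hD : D < K) (F : Type*) [Field F] (k : Fin K) :
    ∃ v : Fin (K - D) → F, ∑ b, v b * L K D k b = 1 ∧
      ∀ j, j ≠ k → j ∉ gamma K D k → ∑ b, v b * (L K D j b : F) = 0 := by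
  obtain ⟨ε, hε⟩ := exists_isDecodingSign hD k.2
  have key : ∀ j : ℕ, ∑ b : Fin (K - D), (if (b : ℕ) ∈ usedSymbols K D k then (ε b : F) else 0) *
      L K D j b = ((∑ b ∈ usedSymbols K D k, ε b * L K D j b : ℤ) : F) := by
    intro j
    rw [Fin.sum_univ_eq_sum_range
      (fun b => (if b ∈ usedSymbols K D k then (ε b : F) else 0) * L K D j b)]
    simp only [ite_mul, zero_mul]
    rw [← Finset.sum_filter, Finset.filter_mem_eq_inter,
      Finset.inter_eq_right.2 hε.used_subset]
    push_cast
    rfl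
  refine ⟨fun b => if (b : ℕ) ∈ usedSymbols K D k then (ε b : F) else 0, ?_, fun j hjk hj => ?_⟩
  · rw [key, hε.coeff_self, Int.cast_one]
  · rw [key]
    rw [hε.mem_gamma_iff, not_and, not_not] at hj
    rw [hj hjk, Int.cast_zero]

/-! ### A scalar linear code and a fitting matrix -/

theorem exists_isIndexCode {K D : ℕ} (hD : D < K) (F : Type*) [Field F] :
    ∃ E, IsIndexCode (reducedProblem K D) F 1 (K - D) E := by
  refine ⟨fun x b => ∑ j : Fin K, (L K D j b : F) * x j 0, fun k => ?_⟩
  obtain ⟨v, hv1, hv0⟩ := exists_decodingVector hD F k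
  refine ⟨fun y z _ => ∑ b, v b * y b -
    ∑ j : (reducedProblem K D).sideInfo k, (∑ b, v b * (L K D j b : F)) * z j 0, fun x => ?_⟩
  funext a
  rw [Subsingleton.elim a 0]
  have h1 : ∑ b, v b * ∑ j : Fin K, (L K D j b : F) * x j 0 =
      ∑ j : Fin K, (∑ b, v b * (L K D j b : F)) * x j 0 := by
    simp only [Finset.mul_sum, Finset.sum_mul, mul_assoc]
    exact Finset.sum_comm
  have h2 : ∑ j : Fin K, (∑ b, v b * (L K D j b : F)) * x j 0 =
      ∑ j ∈ insert k (gamma K D k), (∑ b, v b * (L K D j b : F)) * x j 0 := by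
    refine (Finset.sum_subset (Finset.subset_univ _) fun j _ hj => ?_).symm
    rw [Finset.mem_insert, not_or] at hj
    rw [hv0 j hj.1 hj.2, zero_mul]
  have h3 : ∑ j : (reducedProblem K D).sideInfo k, (∑ b, v b * (L K D j b : F)) * x j 0 =
      ∑ j ∈ gamma K D k, (∑ b, v b * (L K D j b : F)) * x j 0 :=
    Finset.sum_coe_sort (gamma K D k) fun j => (∑ b, v b * (L K D j b : F)) * x j 0
  simp only [h1, h2, h3]
  have hk : k ∉ gamma K D k := (reducedProblem K D).notMem_sideInfo k
  rw [Finset.sum_insert hk, hv1]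
  ring

theorem exists_fits_rank_le {K D : ℕ} (hD : D < K) (F : Type*) [Field F] :
    ∃ A : Matrix (Fin K) (Fin K) F, Fits (reducedProblem K D).graph A ∧ A.rank ≤ K - D := by
  choose v hv1 hv0 using exists_decodingVector hD F
  refine ⟨Matrix.of v * Matrix.of fun (b : Fin (K - D)) (j : Fin K) => (L K D j b : F),
    ⟨fun k => ?_, fun k j hkj hadj => ?_⟩, ?_⟩
  · rw [Matrix.mul_apply]
    exact ne_of_eq_of_ne (hv1 k) one_ne_zero
  · rw [Matrix.mul_apply]
    exact hv0 k j hkj.symm hadj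
  · exact (Matrix.rank_mul_le_left _ _).trans (Matrix.rank_le_width _)

/-! ### The acyclic lower bounds -/

/-- If the side-information of each of the first `n` receivers consists of later messages, the code
word determines `x_{n-1}, …, x_0`, in this order, once the messages from `n` on are known. -/
theorem IsIndexCode.injOn {K n m N : ℕ} {P : Problem K} {F : Type*} [Zero F]
    (hP : ∀ k j : Fin K, (k : ℕ) < n → j ∈ P.sideInfo k → k < j)
    {E : (Fin K → Fin m → F) → (Fin N → F)} (hE : IsIndexCode P F m N E) :
    Set.InjOn E {x | ∀ j : Fin K, n ≤ j → x j = 0} := by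
  intro x hx y hy hxy
  funext k
  induction k using WellFoundedGT.induction with
  | _ k ih =>
    by_cases hk : n ≤ k
    · rw [hx k hk, hy k hk]
    obtain ⟨decode, hd⟩ := hE k
    rw [← hd x, ← hd y, hxy]
    congr 1
    funext j
    exact ih j (hP k j (by omega) j.2)

/-- By counting: the messages supported on the first `n` indices need different code words. -/
theorem IsIndexCode.mul_le {K n m N : ℕ} (hn : n ≤ K) {P : Problem K} {F : Type*} [Field F]
    [Finite F] (hP : ∀ k j : Fin K, (k : ℕ) < n → j ∈ P.sideInfo k → k < j)
    {E : (Fin K → Fin m → F) → (Fin N → F)} (hE : IsIndexCode P F m N E) : n * m ≤ N := by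
  have := Fintype.ofFinite F
  let ext : (Fin n → Fin m → F) → Fin K → Fin m → F := fun y j =>
    if h : (j : ℕ) < n then y ⟨j, h⟩ else 0
  have hinj : Function.Injective (E ∘ ext) := by
    intro y z h
    have h' := hE.injOn hP (x₁ := ext y) (x₂ := ext z)
      (fun j hj => dif_neg (by omega)) (fun j hj => dif_neg (by omega)) h
    funext i
    simpa [ext] using congrFun h' ⟨i, by omega⟩
  have hc := Fintype.card_le_of_injective _ hinj
  simp only [Fintype.card_fun, Fintype.card_fin, ← pow_mul] at hc
  rw [mul_comm]
  exact (Nat.pow_le_pow_iff_right Fintype.one_lt_card).1 hc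

/-- The leading `n × n` block is triangular with nonzero diagonal. -/
theorem Fits.le_rank {K n : ℕ} (hn : n ≤ K) {F : Type*} [Field F] {G : Digraph (Fin K)}
    (hG : ∀ k j : Fin K, (k : ℕ) < n → G.Adj k j → k < j) {A : Matrix (Fin K) (Fin K) F}
    (hA : Fits G A) : n ≤ A.rank := by
  have ht : (A.submatrix (Fin.castLE hn) (Fin.castLE hn)).BlockTriangular id := by
    intro i j hji
    refine hA.2 _ _ (fun h => hji.ne' (Fin.castLE_injective hn h)) fun hadj => ?_
    exact (hG _ _ i.2 hadj).not_gt hji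
  have hu : IsUnit (A.submatrix (Fin.castLE hn) (Fin.castLE hn)) := by
    rw [Matrix.isUnit_iff_isUnit_det, Matrix.det_of_isUpperTriangular ht, isUnit_iff_ne_zero]
    exact Finset.prod_ne_zero_iff.2 fun i _ => hA.1 _
  calc n = (A.submatrix (Fin.castLE hn) (Fin.castLE hn)).rank := by
        rw [Matrix.rank_of_isUnit _ hu, Fintype.card_fin]
    _ ≤ A.rank := Matrix.rank_submatrix_le _ _ _

end IndexCoding

theorem corollary1 (K D : ℕ) (hD : D < K) (F : Type*) [Field F] [Finite F] :
    (∀ k : Fin K, (IndexCoding.reducedProblem K D).sideInfo k ⊆ IndexCoding.oneSided K D k) ∧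
    IndexCoding.IsCapacity (IndexCoding.reducedProblem K D) F (1 / ((K : ℝ) - (D : ℝ))) ∧
    IndexCoding.minrank F (IndexCoding.reducedProblem K D).graph = K - D := by
  have hacyc : ∀ k j : Fin K, (k : ℕ) < K - D →
      j ∈ (IndexCoding.reducedProblem K D).sideInfo k → k < j :=
    fun k j hk hj => IndexCoding.lt_of_mem_gamma hD hk hj
  have hpos : 0 < (K : ℝ) - D := sub_pos.2 (Nat.cast_lt.2 hD)
  refine ⟨IndexCoding.gamma_subset_oneSided hD, ⟨?_, ?_⟩, ?_⟩
  -- the converse by counting, then a code of rate `1 / (K - D)`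
  · rintro R ⟨m, N, hm, hN, ⟨E, hE⟩, rfl⟩
    have h := hE.mul_le (Nat.sub_le K D) hacyc
    rw [div_le_div_iff₀ (Nat.cast_pos.2 hN) hpos, one_mul, ← Nat.cast_sub hD.le, mul_comm]
    exact_mod_cast h
  · intro R hR
    refine hR ⟨1, K - D, one_pos, Nat.sub_pos_of_lt hD, IndexCoding.exists_isIndexCode hD F, ?_⟩
    rw [Nat.cast_sub hD.le, Nat.cast_one]
  · obtain ⟨A, hA, hr⟩ := IndexCoding.exists_fits_rank_le hD F
    refine le_antisymm (le_trans (Nat.sInf_le (show A.rank ∈ _ from ⟨A, hA, rfl⟩)) hr) ?_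
    refine le_csInf ⟨_, A, hA, rfl⟩ ?_
    rintro r ⟨B, hB, rfl⟩
    exact hB.le_rank (Nat.sub_le K D) hacyc
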